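/- **Setting.** Let $B>0$, let $m\le n$, and let streams be $\sigma=(\sigma(1),\dots,\sigma(n))\in\Sigma=[0,B]^n$ with Hamming distance $d$; two streams are adjacent if $d(\sigma,\sigma')=1$. For bounded $c:\Sigma\to\mathbb R$ and $b>0$ put $$\mathsf{LS}_\sigma(c)=\sup_{\sigma':\,d(\sigma,\sigma')=1}|c(\sigma)-c(\sigma')|,\qquad \mathsf{SS}_{\sigma,b}(c)=\sup_{\sigma'\in\Sigma}\mathsf{LS}_{\sigma'}(c)\,e^{-b\,d(\sigma,\sigma')} .$$ A randomised map $M:\Sigma\to\mathbb R$ is $(\varepsilon,\delta)$-differentially private if $\Pr[M(\sigma)\in S]\le e^{\varepsilon}\Pr[M(\sigma')\in S]+\delta$ for all adjacent $\sigma,\sigma'$ and all measurable $S\subseteq\mathbb R$. Let $0<p<1$ and $\frac1{pm}<\lambda<1$. Let $\hat x_{\lambda p}(\sigma)$ be the empirical $\lambda p$-quantile of the first $m$ readings, $$\hat x_{\lambda p}(\sigma)=\min\bigl\{\sigma(i): i\le m,\ |\{j\le m:\sigma(j)<\sigma(i)\}|\ge(1-\lambda p)m\bigr\},$$ with value $B$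 if ties leave this set empty. Let $F$ be the distribution function of a probability distribution with all its mass on $[0,B]$, and let $x_p=\inf\{x: F(x)\ge 1-p\}$. Let the noise $Z$ be either Laplace with mean $0$ and scale $1$ or standard Gaussian, with distribution function $G$. Let $0<\varepsilon_1\le1$, $0<\delta<1$, and let $a,b>0$ satisfy * Laplace: $a\le\frac{\varepsilon_1}{2}$ and $b\le\min\bigl(1,\frac{\varepsilon_1}{2\ln(1/\delta)}\bigr)$; * Gaussian: $a\le\frac{\varepsilon_1}{5\sqrt{2\ln(2/\delta)}}$ and $b\le\frac{\varepsilon_1}{4(1+\ln(2/\delta))}$. Let $0<\beta_{\rm lt}\le\frac12$ and $0<\beta_{\rm rt}<1$, and suppose that $\kappa=\Bigl(1-\frac{(e^b-1)\,G^{-1}(1-\beta_{\rm lt})}{a}\Bigr)^{-1}$ is well defined and positive. Define $$\tau'=\hat x_{\lambda p}+\frac{\kappa\,\mathsf{SS}_{\sigma,b}(\hat x_{\lambda p})}{a}\,G^{-1}(1-\beta_{\rm lt}),\qquad \tau=\tau'+\frac{\mathsf{SS}_{\sigma,b}(\tau')}{a}\,Z,$$ $$\tilde\tau=\hat x_{\lambda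 p}+\frac{\kappa\,\mathsf{SS}_{\sigma,b}(\hat x_{\lambda p})}{a}\,\bigl(Z+G^{-1}(1-\beta_{\rm lt})\bigr),$$ $$\tau_{\max}=\hat x_{\lambda p}+\frac{\kappa\,\mathsf{SS}_{\sigma,b}(\hat x_{\lambda p})}{a}\,\bigl(G^{-1}(1-\beta_{\rm lt})+G^{-1}(1-\beta_{\rm rt})\bigr).$$ **Claim.** 1. The release of $\tau$ and the release of $\tilde\tau$ are both $(\varepsilon_1,\delta)$-differentially private. 2. For every $\sigma$, $\mathsf{SS}_{\sigma,b}(\tau')\le\kappa\,\mathsf{SS}_{\sigma,b}(\hat x_{\lambda p})$; consequently $\tau\le\tilde\tau$ whenever $Z\ge0$. 3. For every $\sigma$ with $x_p\le\hat x_{\lambda p}(\sigma)$, $\Pr[\tau<x_p]\le\beta_{\rm lt}$ and $\Pr[\tilde\tau<x_p]\le\beta_{\rm lt}$. 4. For every $\sigma$, $\Pr[\tilde\tau\le\tau_{\max}]\ge1-\beta_{\rm rt}$; and if $\beta_{\rm rt}\le\frac12$, also $\Pr[\tau\le\tau_{\max}]\ge1-\beta_{\rm rt}$. In 3 and 4 the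 stream $\sigma$ is fixed and the probability is over $Z$ only. -/

import Mathlib

open MeasureTheory ProbabilityTheory

noncomputable section

namespace ThresholdRelease

/-- A stream of `n` readings, each in the interval `[0, B]`. -/
abbrev Stream (B : ℝ) (n : ℕ) : Type := Fin n → Set.Icc (0 : ℝ) B

/-- Two streams are adjacent if they differ in exactly one position. -/
def Adjacent {B : ℝ} {n : ℕ} (σ σ' : Stream B n) : Prop := hammingDist σ σ' = 1

/-- The local sensitivity of `c` at `σ`: the supremum of `|c σ - c σ'|` over the neighbours
`σ'` of `σ`. -/
def localSensitivity {B : ℝ} {n : ℕ} (c : Stream B n → ℝ) (σ : Stream B n) : ℝ :=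
  sSup {r : ℝ | ∃ σ' : Stream B n, Adjacent σ σ' ∧ r = |c σ - c σ'|}

/-- The `b`-smooth sensitivity of `c` at `σ`: the supremum of `LS_{σ'}(c) * exp (-b d(σ, σ'))`
over all streams `σ'`. -/
def smoothSensitivity {B : ℝ} {n : ℕ} (b : ℝ) (c : Stream B n → ℝ) (σ : Stream B n) : ℝ :=
  sSup {r : ℝ | ∃ σ' : Stream B n,
    r = localSensitivity c σ' * Real.exp (-(b * (hammingDist σ σ' : ℝ)))}

/-- The (generalized) inverse of the distribution function of a probability measure on `ℝ`. -/
def cdfInv (μ : Measure ℝ) (u : ℝ) : ℝ := sInf {x : ℝ | u ≤ cdf μ x}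

/-- The `p`-quantile `x_p` of a distribution (with mass `p` to its right). -/
def quantile (F : Measure ℝ) (p : ℝ) : ℝ := cdfInv F (1 - p)

/-- The values among the first `m` readings that have at least `(1 - p) m` of the first `m`
readings strictly below them. -/
def quantileCandidates {B : ℝ} {n : ℕ} (m : ℕ) (p : ℝ) (σ : Stream B n) : Set ℝ :=
  {x : ℝ | ∃ i : Fin n, (i : ℕ) < m ∧ x = σ i ∧
    (1 - p) * (m : ℝ) ≤
      ((Finset.univ.filter fun j : Fin n => (j : ℕ) < m ∧ σ j < σ i).card : ℝ)}

open Classical in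
/-- The empirical `p`-quantile of the first `m` readings: the least candidate. If ties among the
readings leave no candidate, it is the upper end `B` of the range. -/
def empiricalQuantile {B : ℝ} {n : ℕ} (m : ℕ) (p : ℝ) (σ : Stream B n) : ℝ :=
  if (quantileCandidates m p σ).Nonempty then sInf (quantileCandidates m p σ) else B

/-- The Laplace distribution with mean `0` and scale `1`. -/
def laplaceMeasure : Measure ℝ :=
  volume.withDensity fun x : ℝ => ENNReal.ofReal (1 / 2 * Real.exp (-|x|))

/-- The two kinds of noise. -/
inductive Noise : Type
  | laplace : Noise
  | gaussian : Noise

/-- The law of the noise: Laplace of scale `1`, or standard Gaussian. -/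
def Noise.law : Noise → Measure ℝ
  | Noise.laplace => laplaceMeasure
  | Noise.gaussian => gaussianReal 0 1

/-- The choice of the noise parameter `a` and of the smoothing parameter `b` in terms of the
privacy parameters. -/
def Noise.Calibrated : Noise → (ε δ a b : ℝ) → Prop
  | Noise.laplace, ε, δ, a, b =>
      0 < a ∧ a ≤ ε / 2 ∧ 0 < b ∧ b ≤ min 1 (ε / (2 * Real.log (1 / δ)))
  | Noise.gaussian, ε, δ, a, b =>
      0 < a ∧ a ≤ ε / (5 * Real.sqrt (2 * Real.log (2 / δ))) ∧
        0 < b ∧ b ≤ ε / (4 * (1 + Real.log (2 / δ)))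

/-- `(ε, δ)`-differential privacy of a mechanism, given by the law of its output on each stream. -/
def IsDP {B : ℝ} {n : ℕ} (ε δ : ℝ) (M : Stream B n → Measure ℝ) : Prop :=
  ∀ σ σ' : Stream B n, Adjacent σ σ' → ∀ S : Set ℝ, MeasurableSet S →
    M σ S ≤ ENNReal.ofReal (Real.exp ε) * M σ' S + ENNReal.ofReal δ

/-- The offset `G⁻¹(1 - β)`. -/
def offset (ν : Measure ℝ) (β : ℝ) : ℝ := cdfInv ν (1 - β)

/-- The inflation factor `κ`. -/
def kappa (ν : Measure ℝ) (a b β : ℝ) : ℝ := (1 - (Real.exp b - 1) * offset ν β / a)⁻¹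

/-- The inflated scale `κ SS_{σ,b}(q) / a`. -/
def inflatedScale {B : ℝ} {n : ℕ} (ν : Measure ℝ) (a b β : ℝ) (q : Stream B n → ℝ)
    (σ : Stream B n) : ℝ :=
  kappa ν a b β * smoothSensitivity b q σ / a

/-- The shifted quantile `τ'`. -/
def tauPrime {B : ℝ} {n : ℕ} (ν : Measure ℝ) (a b β : ℝ) (q : Stream B n → ℝ)
    (σ : Stream B n) : ℝ :=
  q σ + inflatedScale ν a b β q σ * offset ν β

/-- The threshold `τ' + (SS_{σ,b}(τ') / a) z` for the noise value `z`. -/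
def tau {B : ℝ} {n : ℕ} (ν : Measure ℝ) (a b β : ℝ) (q : Stream B n → ℝ)
    (σ : Stream B n) (z : ℝ) : ℝ :=
  tauPrime ν a b β q σ + smoothSensitivity b (tauPrime ν a b β q) σ / a * z

/-- The threshold `q + (κ SS_{σ,b}(q) / a) (z + G⁻¹(1 - β))` for the noise value `z`. -/
def tauInflated {B : ℝ} {n : ℕ} (ν : Measure ℝ) (a b β : ℝ) (q : Stream B n → ℝ)
    (σ : Stream B n) (z : ℝ) : ℝ :=
  q σ + inflatedScale ν a b β q σ * (z + offset ν β)

/-- The bound `τ_max`. -/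
def tauMax {B : ℝ} {n : ℕ} (ν : Measure ℝ) (a b βlt βrt : ℝ) (q : Stream B n → ℝ)
    (σ : Stream B n) : ℝ :=
  q σ + inflatedScale ν a b βlt q σ * (offset ν βlt + offset ν βrt)

end ThresholdRelease

end

/-! Smooth sensitivity is the least upper bound of the local sensitivity that changes by a factor of
at most `e ^ b` between neighbours. Adding `κ S t` to the quantile, where `S` is its smooth
sensitivity and `t = G⁻¹(1 - βlt) / a`, raises the local sensitivity to at most `(1 + κ (e ^ b - 1)
t) S`. The definition of `κ` makes this equal to `κ S`, so `κ S` is a smooth bound for `τ'`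
(`smoothSensitivity_add_mul_le`).

For privacy, the outputs on neighbouring streams are `A + s Z` and `A' + s' Z`, with `s / s'`
between `e ^ (-b)` and `e ^ b` and `|A - A'| ≤ a s'`. One dilation and one shift of the noise carry
one to the other, and each costs a factor `e ^ (ε / 2)` and a share of `δ`. Both costs come from
comparing densities pointwise off a tail. A Laplace dilation by `e ^ t > 1` with `δ > 1 / e` uses
total variation instead.

The tail bounds are deterministic inequalities in `z`, combined with the symmetry of the noise and
`G⁻¹(1 - β) ≥ 0` for `β ≤ 1 / 2`. -/

namespace ThresholdRelease

/-! ### Local and smooth sensitivity. -/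

section Sensitivity

variable {B : ℝ} {n : ℕ}

theorem localSensitivity_nonneg (c : Stream B n → ℝ) (σ : Stream B n) :
    0 ≤ localSensitivity c σ := by
  refine Real.sSup_nonneg ?_
  rintro _ ⟨σ', -, rfl⟩
  exact abs_nonneg _

theorem localSensitivity_le {c : Stream B n → ℝ} {σ : Stream B n} {K : ℝ} (hK : 0 ≤ K)
    (h : ∀ σ', Adjacent σ σ' → |c σ - c σ'| ≤ K) : localSensitivity c σ ≤ K := by
  refine Real.sSup_le ?_ hK
  rintro _ ⟨σ', h', rfl⟩
  exact h σ' h'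

/-- The uniform bound `hC` is essential: the real `sSup` of an unbounded set is `0`. It is carried
through this part for the same reason. -/
theorem abs_sub_le_localSensitivity {c : Stream B n → ℝ} {C : ℝ}
    (hC : ∀ σ σ', |c σ - c σ'| ≤ C) {σ σ' : Stream B n} (h : Adjacent σ σ') :
    |c σ - c σ'| ≤ localSensitivity c σ := by
  refine le_csSup ⟨C, ?_⟩ ⟨σ', h, rfl⟩
  rintro _ ⟨τ, -, rfl⟩
  exact hC σ τ

theorem smoothSensitivity_nonneg (b : ℝ) (c : Stream B n → ℝ) (σ : Stream B n) :
    0 ≤ smoothSensitivity b c σ := by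
  refine Real.sSup_nonneg ?_
  rintro _ ⟨σ', rfl⟩
  exact mul_nonneg (localSensitivity_nonneg c σ') (Real.exp_pos _).le

theorem smoothSensitivity_le {b : ℝ} {c : Stream B n → ℝ} {σ : Stream B n} {K : ℝ} (hK : 0 ≤ K)
    (h : ∀ σ', localSensitivity c σ' * Real.exp (-(b * (hammingDist σ σ' : ℝ))) ≤ K) :
    smoothSensitivity b c σ ≤ K := by
  refine Real.sSup_le ?_ hK
  rintro _ ⟨σ', rfl⟩
  exact h σ'

theorem le_smoothSensitivity {b : ℝ} (hb : 0 ≤ b) {c : Stream B n → ℝ} {C : ℝ} (hC0 : 0 ≤ C)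
    (hC : ∀ σ σ', |c σ - c σ'| ≤ C) (σ σ' : Stream B n) :
    localSensitivity c σ' * Real.exp (-(b * (hammingDist σ σ' : ℝ))) ≤ smoothSensitivity b c σ := by
  refine le_csSup ⟨C, ?_⟩ ⟨σ', rfl⟩
  rintro _ ⟨τ, rfl⟩
  have h1 : localSensitivity c τ ≤ C := localSensitivity_le hC0 fun σ' _ => hC τ σ'
  have h2 : Real.exp (-(b * (hammingDist σ τ : ℝ))) ≤ 1 := by
    rw [Real.exp_le_one_iff]
    have := mul_nonneg hb (Nat.cast_nonneg (α := ℝ) (hammingDist σ τ))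
    linarith
  calc _ ≤ C * 1 := mul_le_mul h1 h2 (Real.exp_pos _).le hC0
    _ = C := mul_one C

theorem localSensitivity_le_smoothSensitivity {b : ℝ} (hb : 0 ≤ b) {c : Stream B n → ℝ} {C : ℝ}
    (hC0 : 0 ≤ C) (hC : ∀ σ σ', |c σ - c σ'| ≤ C) (σ : Stream B n) :
    localSensitivity c σ ≤ smoothSensitivity b c σ := by
  simpa using le_smoothSensitivity hb hC0 hC σ σ

/-- The triangle inequality for the Hamming distance, applied to each term of the supremum. -/
theorem smoothSensitivity_le_exp_mul {b : ℝ} (hb : 0 ≤ b) {c : Stream B n → ℝ} {C : ℝ}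
    (hC0 : 0 ≤ C) (hC : ∀ σ σ', |c σ - c σ'| ≤ C) (σ σ' : Stream B n) :
    smoothSensitivity b c σ ≤
      Real.exp (b * (hammingDist σ σ' : ℝ)) * smoothSensitivity b c σ' := by
  refine smoothSensitivity_le
    (mul_nonneg (Real.exp_pos _).le (smoothSensitivity_nonneg b c σ')) fun τ => ?_
  have h1 := le_smoothSensitivity hb hC0 hC σ' τ
  have h2 : (hammingDist σ' τ : ℝ) ≤ hammingDist σ σ' + hammingDist σ τ := by
    rw [hammingDist_comm σ σ']
    exact_mod_cast hammingDist_triangle σ' σ τ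
  have h3 : Real.exp (-(b * (hammingDist σ τ : ℝ))) ≤
      Real.exp (b * (hammingDist σ σ' : ℝ)) * Real.exp (-(b * (hammingDist σ' τ : ℝ))) := by
    rw [← Real.exp_add, Real.exp_le_exp]
    nlinarith
  calc _ ≤ localSensitivity c τ *
        (Real.exp (b * (hammingDist σ σ' : ℝ)) * Real.exp (-(b * (hammingDist σ' τ : ℝ)))) :=
        mul_le_mul_of_nonneg_left h3 (localSensitivity_nonneg c τ)
    _ = Real.exp (b * (hammingDist σ σ' : ℝ)) *
        (localSensitivity c τ * Real.exp (-(b * (hammingDist σ' τ : ℝ)))) := by ring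
    _ ≤ _ := mul_le_mul_of_nonneg_left h1 (Real.exp_pos _).le

theorem Adjacent.symm {σ σ' : Stream B n} (h : Adjacent σ σ') : Adjacent σ' σ := by
  rw [Adjacent, hammingDist_comm]
  exact h

theorem Adjacent.smoothSensitivity_le_exp_mul {b : ℝ} (hb : 0 ≤ b) {c : Stream B n → ℝ} {C : ℝ}
    (hC0 : 0 ≤ C) (hC : ∀ σ σ', |c σ - c σ'| ≤ C) {σ σ' : Stream B n} (h : Adjacent σ σ') :
    smoothSensitivity b c σ ≤ Real.exp b * smoothSensitivity b c σ' := by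
  have h1 := ThresholdRelease.smoothSensitivity_le_exp_mul hb hC0 hC σ σ'
  rw [Adjacent] at h
  simpa [h] using h1

theorem smoothSensitivity_le_of_bound {b : ℝ} (hb : 0 ≤ b) {c : Stream B n → ℝ} {C : ℝ}
    (hC0 : 0 ≤ C) (hC : ∀ σ σ', |c σ - c σ'| ≤ C) (σ : Stream B n) :
    smoothSensitivity b c σ ≤ C := by
  refine smoothSensitivity_le hC0 fun τ => ?_
  have h1 : localSensitivity c τ ≤ C := localSensitivity_le hC0 fun σ' _ => hC τ σ'
  have h2 : Real.exp (-(b * (hammingDist σ τ : ℝ))) ≤ 1 := by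
    rw [Real.exp_le_one_iff]
    have := mul_nonneg hb (Nat.cast_nonneg (α := ℝ) (hammingDist σ τ))
    linarith
  calc _ ≤ C * 1 := mul_le_mul h1 h2 (Real.exp_pos _).le hC0
    _ = C := mul_one C

/-- Adding a multiple of the smooth sensitivity to `c` inflates the smooth sensitivity by at most
the factor `κ` that solves `1 + κ (e ^ b - 1) t = κ`. -/
theorem smoothSensitivity_add_mul_le {b : ℝ} (hb : 0 ≤ b) {c : Stream B n → ℝ} {C : ℝ}
    (hC0 : 0 ≤ C) (hC : ∀ σ σ', |c σ - c σ'| ≤ C) {κ t : ℝ} (hκ : 0 ≤ κ) (ht : 0 ≤ t)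
    (hκt : 1 + κ * ((Real.exp b - 1) * t) = κ) (σ : Stream B n) :
    smoothSensitivity b (fun σ => c σ + κ * smoothSensitivity b c σ * t) σ ≤
      κ * smoothSensitivity b c σ := by
  have hS := smoothSensitivity_nonneg b c
  have hE : 1 ≤ Real.exp b := Real.one_le_exp hb
  have hloc : ∀ σ, localSensitivity (fun σ => c σ + κ * smoothSensitivity b c σ * t) σ ≤
      κ * smoothSensitivity b c σ := by
    intro σ
    refine localSensitivity_le (mul_nonneg hκ (hS σ)) fun σ' h => ?_
    have h1 := h.smoothSensitivity_le_exp_mul hb hC0 hC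
    have h2 := h.symm.smoothSensitivity_le_exp_mul hb hC0 hC
    have h3 := (abs_sub_le_localSensitivity hC h).trans
      (localSensitivity_le_smoothSensitivity hb hC0 hC σ)
    -- The bound has to be in terms of the value at `σ` alone, whichever of the two values is
    -- larger. If the value at `σ` is the larger, the excess is at most `e ^ b - 1` times the
    -- smaller one.
    have h4 : |smoothSensitivity b c σ - smoothSensitivity b c σ'| ≤
        (Real.exp b - 1) * smoothSensitivity b c σ := by
      rw [abs_sub_le_iff]
      constructor
      · rcases le_total (smoothSensitivity b c σ) (smoothSensitivity b c σ') with h5 | h5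
        · nlinarith [hS σ]
        · nlinarith [hS σ]
      · linarith
    have h6 : (c σ + κ * smoothSensitivity b c σ * t) - (c σ' + κ * smoothSensitivity b c σ' * t)
        = (c σ - c σ') + κ * t * (smoothSensitivity b c σ - smoothSensitivity b c σ') := by ring
    change |(c σ + κ * smoothSensitivity b c σ * t) -
      (c σ' + κ * smoothSensitivity b c σ' * t)| ≤ _
    rw [h6]
    calc _ ≤ |c σ - c σ'| + |κ * t * (smoothSensitivity b c σ - smoothSensitivity b c σ')| :=
          abs_add_le _ _
      _ ≤ smoothSensitivity b c σ + κ * t * ((Real.exp b - 1) * smoothSensitivity b c σ) := by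
          rw [abs_mul, abs_of_nonneg (mul_nonneg hκ ht)]
          exact add_le_add h3 (mul_le_mul_of_nonneg_left h4 (mul_nonneg hκ ht))
      _ = (1 + κ * ((Real.exp b - 1) * t)) * smoothSensitivity b c σ := by ring
      _ = _ := by rw [hκt]
  -- `κ S` bounds the local sensitivity by `hloc` and inherits the smoothness of `S`, so it
  -- dominates the smooth sensitivity.
  refine smoothSensitivity_le (mul_nonneg hκ (hS σ)) fun σ' => ?_
  have h1 := smoothSensitivity_le_exp_mul hb hC0 hC σ' σ
  rw [hammingDist_comm] at h1
  calc _ ≤ κ * (Real.exp (b * (hammingDist σ σ' : ℝ)) * smoothSensitivity b c σ) *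
        Real.exp (-(b * (hammingDist σ σ' : ℝ))) :=
        mul_le_mul_of_nonneg_right ((hloc σ').trans (mul_le_mul_of_nonneg_left h1 hκ))
          (Real.exp_pos _).le
    _ = κ * smoothSensitivity b c σ * (Real.exp (b * (hammingDist σ σ' : ℝ)) *
        Real.exp (-(b * (hammingDist σ σ' : ℝ)))) := by ring
    _ = _ := by rw [← Real.exp_add, add_neg_cancel, Real.exp_zero, mul_one]

theorem empiricalQuantile_mem_Icc (hB : 0 ≤ B) (m : ℕ) (p : ℝ) (σ : Stream B n) :
    empiricalQuantile m p σ ∈ Set.Icc 0 B := by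
  have hnn : ∀ x ∈ quantileCandidates m p σ, 0 ≤ x := by
    rintro _ ⟨i, -, rfl, -⟩
    exact (σ i).2.1
  unfold empiricalQuantile
  split_ifs with h
  · refine ⟨Real.sInf_nonneg hnn, ?_⟩
    obtain ⟨x, hx⟩ := h
    refine (csInf_le ⟨0, hnn⟩ hx).trans ?_
    obtain ⟨i, -, rfl, -⟩ := hx
    exact (σ i).2.2
  · exact ⟨hB, le_rfl⟩

end Sensitivity

/-! ### Measures with a density under affine maps. -/

section Density

theorem withDensity_affine_preimage {f : ℝ → ℝ} {c r : ℝ} (hr : r ≠ 0)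
    {T : Set ℝ} (hT : MeasurableSet T) :
    (volume.withDensity fun x => ENNReal.ofReal (f x)) {z | c + r * z ∈ T} =
      ∫⁻ w in T, ENNReal.ofReal (|r|⁻¹ * f ((w - c) / r)) := by
  have hm : MeasurableSet {z : ℝ | c + r * z ∈ T} := by
    have : Measurable fun z : ℝ => c + r * z := by fun_prop
    exact this hT
  have himg : (fun z : ℝ => c + r * z) '' {z : ℝ | c + r * z ∈ T} = T := by
    ext w
    constructor
    · rintro ⟨z, hz, rfl⟩
      exact hz
    · intro hw
      have h : c + r * ((w - c) / r) = w := by field_simp; ring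
      exact ⟨(w - c) / r, by simpa only [Set.mem_ofPred_eq, h] using hw, h⟩
  have hder : ∀ z ∈ {z : ℝ | c + r * z ∈ T},
      HasDerivWithinAt (fun z : ℝ => c + r * z) r {z : ℝ | c + r * z ∈ T} z := by
    intro z _
    simpa using (((hasDerivAt_id z).const_mul r).const_add c).hasDerivWithinAt
  have hinj : Set.InjOn (fun z : ℝ => c + r * z) {z : ℝ | c + r * z ∈ T} := by
    intro x _ y _ hxy
    simpa [hr] using hxy
  have key := lintegral_image_eq_lintegral_abs_deriv_mul hm hder hinj
    (fun w => ENNReal.ofReal (|r|⁻¹ * f ((w - c) / r)))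
  rw [himg] at key
  rw [key, withDensity_apply _ hm]
  refine lintegral_congr fun z => ?_
  have h1 : (c + r * z - c) / r = z := by field_simp; ring
  rw [h1, ← ENNReal.ofReal_mul (abs_nonneg r), ← mul_assoc,
    mul_inv_cancel₀ (abs_ne_zero.mpr hr), one_mul]

/-- If off `E` the density is at most `K` times that of its image under an affine map, then the
measure is at most `K` times the image measure, up to the mass of `E`. -/
theorem withDensity_le_mul_add {f : ℝ → ℝ} {c r K : ℝ} (hr : r ≠ 0) (hK : 0 ≤ K)
    {T E : Set ℝ} (hT : MeasurableSet T) (hE : MeasurableSet E)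
    (h : ∀ w ∉ E, f w ≤ K * (|r|⁻¹ * f ((w - c) / r))) :
    (volume.withDensity fun x => ENNReal.ofReal (f x)) T ≤
      ENNReal.ofReal K *
          (volume.withDensity fun x => ENNReal.ofReal (f x)) {z | c + r * z ∈ T} +
        (volume.withDensity fun x => ENNReal.ofReal (f x)) E := by
  rw [withDensity_affine_preimage hr hT]
  refine (measure_le_inter_add_sdiff _ T E).trans ?_
  rw [add_comm]
  refine add_le_add ?_ (measure_mono Set.inter_subset_right)
  rw [withDensity_apply _ (hT.diff hE), ← lintegral_const_mul' _ _ ENNReal.ofReal_ne_top]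
  refine (setLIntegral_mono' (hT.diff hE) fun w hw => ?_).trans
    (lintegral_mono_set Set.sdiff_subset)
  rw [← ENNReal.ofReal_mul hK]
  exact ENNReal.ofReal_le_ofReal (h w hw.2)

theorem withDensity_le_affine_preimage {f : ℝ → ℝ} {c r : ℝ} (hr : r ≠ 0) {T : Set ℝ}
    (hT : MeasurableSet T) (h : ∀ w ∈ T, f w ≤ |r|⁻¹ * f ((w - c) / r)) :
    (volume.withDensity fun x => ENNReal.ofReal (f x)) T ≤
      (volume.withDensity fun x => ENNReal.ofReal (f x)) {z | c + r * z ∈ T} := by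
  rw [withDensity_affine_preimage hr hT, withDensity_apply _ hT]
  exact setLIntegral_mono' hT fun w hw => ENNReal.ofReal_le_ofReal (h w hw)

theorem affine_preimage_le_withDensity {f : ℝ → ℝ} {c r : ℝ} (hr : r ≠ 0) {T : Set ℝ}
    (hT : MeasurableSet T) (h : ∀ w ∈ T, |r|⁻¹ * f ((w - c) / r) ≤ f w) :
    (volume.withDensity fun x => ENNReal.ofReal (f x)) {z | c + r * z ∈ T} ≤
      (volume.withDensity fun x => ENNReal.ofReal (f x)) T := by
  rw [withDensity_affine_preimage hr hT, withDensity_apply _ hT]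
  exact setLIntegral_mono' hT fun w hw => ENNReal.ofReal_le_ofReal (h w hw)

end Density

/-! ### The noise laws: density, symmetry, Laplace tails. -/

/-- The density of the noise. -/
noncomputable def Noise.density : Noise → ℝ → ℝ
  | Noise.laplace, x => 1 / 2 * Real.exp (-|x|)
  | Noise.gaussian, x => (Real.sqrt (2 * Real.pi))⁻¹ * Real.exp (-(x ^ 2 / 2))

theorem Noise.law_eq (noise : Noise) :
    noise.law = volume.withDensity fun x => ENNReal.ofReal (noise.density x) := by
  cases noise with
  | laplace => rfl
  | gaussian =>
    simp only [Noise.law, Noise.density]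
    rw [gaussianReal_of_var_ne_zero 0 one_ne_zero]
    congr 1
    funext x
    simp [gaussianPDF, gaussianPDFReal, neg_div]

theorem Noise.density_pos (noise : Noise) (x : ℝ) : 0 < noise.density x := by
  cases noise <;> simp only [Noise.density] <;> positivity

theorem Noise.density_neg (noise : Noise) (x : ℝ) : noise.density (-x) = noise.density x := by
  cases noise <;> simp [Noise.density]

theorem Noise.measurable_density (noise : Noise) : Measurable noise.density := by
  cases noise
  · change Measurable fun x : ℝ => 1 / 2 * Real.exp (-|x|)
    fun_prop
  · change Measurable fun x : ℝ => (Real.sqrt (2 * Real.pi))⁻¹ * Real.exp (-(x ^ 2 / 2))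
    fun_prop

theorem Noise.law_neg_preimage (noise : Noise) {T : Set ℝ} (hT : MeasurableSet T) :
    noise.law {z | -z ∈ T} = noise.law T := by
  have h := withDensity_affine_preimage (f := noise.density) (c := 0) (r := -1) (by norm_num) hT
  rw [noise.law_eq, withDensity_apply _ hT]
  simpa [noise.density_neg, div_neg] using h

/-- Mass on every interval around `0` is what makes the inequality in `cdf_law_lt_half` strict. -/
instance Noise.isOpenPosMeasure_law (noise : Noise) : noise.law.IsOpenPosMeasure := by
  rw [noise.law_eq]
  refine (withDensity_absolutelyContinuous' ?_ ?_).isOpenPosMeasure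
  · exact noise.measurable_density.ennreal_ofReal.aemeasurable
  · exact Filter.Eventually.of_forall fun x => by simpa using noise.density_pos x

section Laplace

theorem laplaceMeasure_Ioi {t : ℝ} (ht : 0 ≤ t) :
    laplaceMeasure (Set.Ioi t) = ENNReal.ofReal (1 / 2 * Real.exp (-t)) := by
  rw [laplaceMeasure, withDensity_apply _ measurableSet_Ioi]
  have h1 : ∫⁻ x in Set.Ioi t, ENNReal.ofReal (1 / 2 * Real.exp (-|x|)) =
      ∫⁻ x in Set.Ioi t, ENNReal.ofReal (1 / 2 * Real.exp (-x)) := by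
    refine setLIntegral_congr_fun measurableSet_Ioi fun x hx => ?_
    simp only [abs_of_pos (lt_of_le_of_lt ht hx)]
  rw [h1, ← ofReal_integral_eq_lintegral_ofReal ((integrableOn_exp_neg_Ioi t).const_mul _)
    (Filter.Eventually.of_forall fun x => by positivity), integral_const_mul,
    integral_exp_neg_Ioi]

theorem laplaceMeasure_lt_abs {t : ℝ} (ht : 0 ≤ t) :
    laplaceMeasure {x | t < |x|} = ENNReal.ofReal (Real.exp (-t)) := by
  have h1 : {x : ℝ | t < |x|} = Set.Ioi t ∪ {x | -x ∈ Set.Ioi t} := by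
    ext x
    simp [lt_abs]
  have hm : MeasurableSet {x : ℝ | -x ∈ Set.Ioi t} := measurable_neg measurableSet_Ioi
  rw [h1, measure_union _ hm]
  · have h2 := Noise.laplace.law_neg_preimage (T := Set.Ioi t) measurableSet_Ioi
    change laplaceMeasure _ = laplaceMeasure _ at h2
    rw [h2, laplaceMeasure_Ioi ht, ← ENNReal.ofReal_add (by positivity) (by positivity)]
    congr 1
    ring
  · rw [Set.disjoint_left]
    intro x hx hx'
    simp only [Set.mem_Ioi, Set.mem_ofPred_eq] at hx hx'
    linarith

instance isProbabilityMeasure_laplaceMeasure : IsProbabilityMeasure laplaceMeasure := by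
  refine ⟨?_⟩
  have h0 : laplaceMeasure {(0 : ℝ)} = 0 := by
    rw [laplaceMeasure, withDensity_apply _ (measurableSet_singleton 0)]
    simp
  have h1 : ({x : ℝ | 0 < |x|})ᶜ = {0} := by
    ext x
    simp
  have hm : MeasurableSet {x : ℝ | 0 < |x|} := measurableSet_lt measurable_const measurable_abs
  rw [← measure_add_measure_compl hm, h1, h0, laplaceMeasure_lt_abs le_rfl]
  simp

end Laplace

instance Noise.isProbabilityMeasure_law (noise : Noise) : IsProbabilityMeasure noise.law := by
  cases noise
  · exact isProbabilityMeasure_laplaceMeasure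
  · exact inferInstanceAs (IsProbabilityMeasure (gaussianReal 0 1))

/-! ### Generalized inverses and the offset. -/

section Offset

theorem cdfInv_set_bddBelow {μ : Measure ℝ} {u : ℝ} (hu : 0 < u) :
    BddBelow {x : ℝ | u ≤ cdf μ x} := by
  have h := (tendsto_cdf_atBot μ).eventually (gt_mem_nhds hu)
  obtain ⟨y, hy⟩ := h.exists
  refine ⟨y, fun x hx => ?_⟩
  by_contra! hxy
  exact absurd (hx.trans (monotone_cdf μ hxy.le)) (not_le.mpr hy)

theorem cdfInv_set_nonempty {μ : Measure ℝ} {u : ℝ} (hu : u < 1) :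
    {x : ℝ | u ≤ cdf μ x}.Nonempty := by
  have h := (tendsto_cdf_atTop μ).eventually (lt_mem_nhds hu)
  obtain ⟨y, hy⟩ := h.exists
  exact ⟨y, hy.le⟩

/-- The infimum is attained because a distribution function is right continuous. -/
theorem le_cdf_cdfInv {μ : Measure ℝ} {u : ℝ} (hu0 : 0 < u) (hu1 : u < 1) :
    u ≤ cdf μ (cdfInv μ u) := by
  have hc : ContinuousWithinAt (cdf μ) (Set.Ioi (cdfInv μ u)) (cdfInv μ u) :=
    ((cdf μ).right_continuous _).mono Set.Ioi_subset_Ici_self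
  refine ge_of_tendsto hc (Filter.eventually_of_mem self_mem_nhdsWithin fun x hx => ?_)
  obtain ⟨y, hy, hyx⟩ := (csInf_lt_iff (cdfInv_set_bddBelow hu0) (cdfInv_set_nonempty hu1)).mp hx
  exact le_trans hy (monotone_cdf μ hyx.le)

theorem ofReal_le_law_Iic_offset (noise : Noise) {β : ℝ} (h0 : 0 < β) (h1 : β < 1) :
    ENNReal.ofReal (1 - β) ≤ noise.law (Set.Iic (offset noise.law β)) := by
  rw [← ofReal_cdf]
  exact ENNReal.ofReal_le_ofReal (le_cdf_cdfInv (by linarith) (by linarith))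

theorem law_Iio_neg_offset_le (noise : Noise) {β : ℝ} (h0 : 0 < β) (h1 : β < 1) :
    noise.law (Set.Iio (-offset noise.law β)) ≤ ENNReal.ofReal β := by
  have h2 : Set.Iio (-offset noise.law β) = {z | -z ∈ Set.Ioi (offset noise.law β)} := by
    ext z
    simp [lt_neg]
  rw [h2, noise.law_neg_preimage measurableSet_Ioi, ← Set.compl_Iic,
    prob_compl_eq_one_sub measurableSet_Iic, tsub_le_iff_right]
  calc (1 : ENNReal) = ENNReal.ofReal β + ENNReal.ofReal (1 - β) := by
        rw [← ENNReal.ofReal_add h0.le (by linarith)]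
        simp
    _ ≤ _ := add_le_add le_rfl (ofReal_le_law_Iic_offset noise h0 h1)

/-- By symmetry the two outer tails have equal mass, and the interval between them has positive
mass. Strictness is needed for `offset_nonneg` at `β = 1 / 2`. -/
theorem cdf_law_lt_half (noise : Noise) {x : ℝ} (hx : x < 0) : cdf noise.law x < 1 / 2 := by
  have hneg : noise.law.real (Set.Ici (-x)) = noise.law.real (Set.Iic x) := by
    rw [measureReal_def, measureReal_def, ← noise.law_neg_preimage measurableSet_Iic]
    congr 2
    ext z
    simp [neg_le]
  have hpos : 0 < noise.law.real (Set.Ioo x (-x)) := by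
    rw [measureReal_def]
    refine ENNReal.toReal_pos ?_ (measure_ne_top _ _)
    exact (isOpen_Ioo.measure_pos _ (Set.nonempty_Ioo.mpr (by linarith))).ne'
  have hsum : noise.law.real (Set.Iic x) + noise.law.real (Set.Ioo x (-x)) +
      noise.law.real (Set.Ici (-x)) = 1 := by
    rw [← measureReal_union _ measurableSet_Ioo, ← measureReal_union _ measurableSet_Ici,
      Set.Iic_union_Ioo_eq_Iio (by linarith), Set.Iio_union_Ici, probReal_univ]
    · rw [Set.Iic_union_Ioo_eq_Iio (by linarith), Set.disjoint_left]
      intro z hz hz'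
      exact absurd (Set.mem_Iio.mp hz) (not_lt.mpr hz')
    · rw [Set.disjoint_left]
      intro z hz hz'
      exact absurd hz'.1 (not_lt.mpr hz)
  rw [cdf_eq_real]
  linarith

theorem offset_nonneg (noise : Noise) {β : ℝ} (h : β ≤ 1 / 2) : 0 ≤ offset noise.law β := by
  refine Real.sInf_nonneg fun x hx => ?_
  by_contra! hx0
  have h1 := cdf_law_lt_half noise hx0
  simp only [Set.mem_ofPred_eq] at hx
  linarith

end Offset

/-! ### Laplace noise under dilation and shift. -/

section Laplace

/-- It suffices to take `r = e`. Multiplying by `e ^ w` leaves `1 ≤ e ^ (w - 1) + e ^ (-(e - 1) w)`.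
Replacing the last exponential by its tangent where the exponent is `-1` reduces this to `h1`. -/
theorem exp_neg_sub_exp_neg_mul_le {r w : ℝ} (hr : r ≤ Real.exp 1) (hw : 0 ≤ w) :
    Real.exp (-w) - Real.exp (-(r * w)) ≤ Real.exp (-1) := by
  have he : 2.7182818283 < Real.exp 1 := Real.exp_one_gt_d9
  have he' : Real.exp 1 < 2.7182818286 := Real.exp_one_lt_d9
  -- Slope of a line below `e ^ w`, close to its tangent at `1 / 2`; the minimum of the right side
  -- of `h1`, at `w = log (e - 1)`, is near that point.
  have hhalf : 1.64 ≤ Real.exp (1 / 2) := by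
    have h : Real.exp (1 / 2) * Real.exp (1 / 2) = Real.exp 1 := by
      rw [← Real.exp_add]
      norm_num
    nlinarith [Real.exp_pos (1 / 2)]
  -- a lower bound for the exponential in place of its tangent line of slope `e - 1`
  have h1 : Real.exp 1 ≤ Real.exp w + 2 - (Real.exp 1 - 1) * w := by
    rcases le_total w 1 with h | h
    · have h2 : Real.exp w = Real.exp (1 / 2) * Real.exp (w - 1 / 2) := by
        rw [← Real.exp_add]
        ring_nf
      have h3 := Real.add_one_le_exp (w - 1 / 2)
      have h4 : 1.64 * (w + 1 / 2) ≤ Real.exp w := by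
        rw [h2]
        exact mul_le_mul hhalf (by linarith) (by linarith) (by linarith)
      nlinarith
    · have h2 : Real.exp w = Real.exp 1 * Real.exp (w - 1) := by
        rw [← Real.exp_add]
        ring_nf
      have h3 := Real.add_one_le_exp (w - 1)
      nlinarith
  have h2 : Real.exp (-1) * (2 - (Real.exp 1 - 1) * w) ≤ Real.exp (-((Real.exp 1 - 1) * w)) := by
    have h3 : Real.exp (-((Real.exp 1 - 1) * w)) =
        Real.exp (-1) * Real.exp (1 - (Real.exp 1 - 1) * w) := by
      rw [← Real.exp_add]
      ring_nf
    rw [h3]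
    refine mul_le_mul_of_nonneg_left ?_ (Real.exp_pos _).le
    linarith [Real.add_one_le_exp (1 - (Real.exp 1 - 1) * w)]
  have h3 : Real.exp (-1) * Real.exp 1 = 1 := by
    rw [← Real.exp_add]
    simp
  have h4 : 1 ≤ Real.exp (-1) * Real.exp w + Real.exp (-((Real.exp 1 - 1) * w)) := by
    nlinarith [mul_le_mul_of_nonneg_left h1 (Real.exp_pos (-1)).le]
  have h5 : Real.exp (-(Real.exp 1 * w)) ≤ Real.exp (-(r * w)) :=
    Real.exp_le_exp.mpr (neg_le_neg (mul_le_mul_of_nonneg_right hr hw))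
  have h6 : Real.exp (-(Real.exp 1 * w)) =
      Real.exp (-w) * Real.exp (-((Real.exp 1 - 1) * w)) := by
    rw [← Real.exp_add]
    ring_nf
  have h7 : Real.exp (-w) * Real.exp w = 1 := by
    rw [← Real.exp_add]
    simp
  nlinarith [mul_le_mul_of_nonneg_left h4 (Real.exp_pos (-w)).le]

theorem laplace_density_eq : Noise.laplace.density = fun x => 1 / 2 * Real.exp (-|x|) := rfl

theorem laplaceMeasure_real_lt_abs {t : ℝ} (ht : 0 ≤ t) :
    laplaceMeasure.real {x | t < |x|} = Real.exp (-t) := by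
  rw [measureReal_def, laplaceMeasure_lt_abs ht, ENNReal.toReal_ofReal (Real.exp_pos _).le]

/-- The total variation distance between Laplace distributions whose scales have a ratio of at most
`e` is at most `1 / e`. -/
theorem laplaceMeasure_le_dilation_add {t : ℝ} (ht0 : 0 < t) (ht1 : t ≤ 1) {T : Set ℝ}
    (hT : MeasurableSet T) :
    laplaceMeasure.real T ≤ laplaceMeasure.real {z | 0 + Real.exp t * z ∈ T} + Real.exp (-1) := by
  set r := Real.exp t with hr
  have hr0 : 0 < r := Real.exp_pos t
  have hr1 : r ≠ 0 := hr0.ne'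
  have hr2 : 1 < r := Real.one_lt_exp_iff.mpr ht0
  have hinv : |r|⁻¹ = Real.exp (-t) := by rw [abs_of_pos hr0, hr, Real.exp_neg]
  -- The densities of `Z` and `r Z` cross at `|w| = z₀`; beyond it the dilated one is larger.
  set z₀ := t / (1 - r⁻¹) with hz₀
  have hd : 0 < 1 - r⁻¹ := by
    have := inv_lt_one_of_one_lt₀ hr2
    linarith
  have hz₀' : 0 ≤ z₀ := (div_pos ht0 hd).le
  have hdens : ∀ w : ℝ, |r|⁻¹ * (1 / 2 * Real.exp (-|(w - 0) / r|)) =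
      1 / 2 * Real.exp (-t - |w| * r⁻¹) := by
    intro w
    rw [hinv, sub_zero, abs_div, abs_of_pos hr0, sub_eq_add_neg, Real.exp_add, div_eq_mul_inv]
    ring_nf
  set E : Set ℝ := {w | z₀ < |w|} with hE
  have hEm : MeasurableSet E := measurableSet_lt measurable_const measurable_abs
  have hm : Measurable fun z : ℝ => 0 + r * z := by fun_prop
  -- the dilated law
  set ν : Set ℝ → ℝ := fun S => laplaceMeasure.real {z | 0 + r * z ∈ S} with hν
  have hle : ∀ S ⊆ E, MeasurableSet S → laplaceMeasure.real S ≤ ν S := by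
    intro S hSE hS
    refine ENNReal.toReal_mono (measure_ne_top _ _) ?_
    refine withDensity_le_affine_preimage hr1 hS fun w hw => ?_
    rw [hdens]
    have h1 : z₀ < |w| := hSE hw
    rw [hz₀, div_lt_iff₀ hd] at h1
    gcongr
    linarith
  have hge : ∀ S ⊆ Eᶜ, MeasurableSet S → ν S ≤ laplaceMeasure.real S := by
    intro S hSE hS
    refine ENNReal.toReal_mono (measure_ne_top _ _) ?_
    refine affine_preimage_le_withDensity hr1 hS fun w hw => ?_
    rw [hdens]
    have h1 : |w| ≤ z₀ := not_lt.mp (hSE hw)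
    rw [hz₀, le_div_iff₀ hd] at h1
    gcongr
    linarith
  have hsplit : ∀ S F : Set ℝ, MeasurableSet F →
      laplaceMeasure.real S = laplaceMeasure.real (S ∩ F) + laplaceMeasure.real (S \ F) :=
    fun S F hF => (measureReal_inter_add_sdiff hF).symm
  have hνsplit : ∀ S F : Set ℝ, MeasurableSet F → ν S = ν (S ∩ F) + ν (S \ F) :=
    fun S F hF => (measureReal_inter_add_sdiff (μ := laplaceMeasure)
      (s := {z | 0 + r * z ∈ S}) (hm hF)).symm
  have hEμ : laplaceMeasure.real E = Real.exp (-z₀) := laplaceMeasure_real_lt_abs hz₀'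
  have hEν : ν E = Real.exp (-(z₀ / r)) := by
    rw [← laplaceMeasure_real_lt_abs (div_nonneg hz₀' hr0.le)]
    simp only [hν, hE]
    congr 1
    ext z
    simp only [Set.mem_ofPred_eq, zero_add, abs_mul, abs_of_pos hr0]
    rw [div_lt_iff₀ hr0, mul_comm]
  have h1 := hsplit T E hEm
  have h2 := hνsplit T E hEm
  have h3 := hle (T ∩ E) Set.inter_subset_right (hT.inter hEm)
  have h4 := hge (Eᶜ \ T) Set.sdiff_subset (hEm.compl.diff hT)
  have h5 := hsplit Eᶜ T hT
  have h6 := hνsplit Eᶜ T hT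
  have h7 : laplaceMeasure.real Eᶜ = 1 - laplaceMeasure.real E := probReal_compl_eq_one_sub hEm
  have h8 : ν Eᶜ = 1 - ν E := probReal_compl_eq_one_sub (μ := laplaceMeasure) (hm hEm)
  have h9 : Eᶜ ∩ T = T \ E := by
    ext z
    simp [and_comm]
  rw [h9] at h5 h6
  -- The law exceeds its dilation on `T` by at most the excess on all of `Eᶜ`, which equals `ν E -
  -- laplaceMeasure.real E = e ^ (-z₀ / r) - e ^ (-z₀)`.
  have h10 := exp_neg_sub_exp_neg_mul_le (r := r) (w := z₀ / r)
    (Real.exp_le_exp.mpr ht1) (div_nonneg hz₀' hr0.le)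
  rw [mul_div_cancel₀ _ hr1] at h10
  change laplaceMeasure.real T ≤ ν T + _
  linarith

/-- A contraction (`t ≤ 0`) is compared off the tail `|w| > log (1 / δ)`, whose mass is exactly `δ`.
An expansion has density ratio at most `e ^ t`, which suffices if `log (1 / δ) ≥ 1`, since then `b ≤
ε / 2`. Otherwise `δ > 1 / e` and the total variation bound applies. -/
theorem laplace_dilation {ε δ b t : ℝ} (hε0 : 0 < ε) (hε1 : ε ≤ 1) (hδ0 : 0 < δ) (hδ1 : δ < 1)
    (hb : b ≤ min 1 (ε / (2 * Real.log (1 / δ)))) (ht : |t| ≤ b) {T : Set ℝ}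
    (hT : MeasurableSet T) :
    laplaceMeasure T ≤ ENNReal.ofReal (Real.exp (ε / 2)) *
      laplaceMeasure {z | 0 + Real.exp t * z ∈ T} + ENNReal.ofReal δ := by
  set l := Real.log (1 / δ) with hl
  have hl0 : 0 < l := Real.log_pos (by rw [lt_div_iff₀ hδ0]; linarith)
  have hexpl : Real.exp (-l) = δ := by
    rw [hl, one_div, Real.log_inv, neg_neg, Real.exp_log hδ0]
  have hb1 : b ≤ 1 := hb.trans (min_le_left _ _)
  have hb2 : l * b ≤ ε / 2 := by
    have h := hb.trans (min_le_right _ _)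
    rw [le_div_iff₀ (by positivity)] at h
    linarith
  have htb := abs_le.mp ht
  have hr : Real.exp t ≠ 0 := (Real.exp_pos t).ne'
  have hdens : ∀ w : ℝ, Real.exp (ε / 2) *
      (|Real.exp t|⁻¹ * (1 / 2 * Real.exp (-|(w - 0) / Real.exp t|))) =
      1 / 2 * Real.exp (ε / 2 - t - |w| * Real.exp (-t)) := by
    intro w
    rw [abs_of_pos (Real.exp_pos t), sub_zero, abs_div, abs_of_pos (Real.exp_pos t),
      div_eq_mul_inv |w|, ← Real.exp_neg, sub_eq_add_neg (ε / 2 - t), sub_eq_add_neg (ε / 2),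
      Real.exp_add, Real.exp_add]
    ring
  rcases le_or_gt t 0 with h0 | h0
  · have hEm : MeasurableSet {x : ℝ | l < |x|} := measurableSet_lt measurable_const measurable_abs
    have key := withDensity_le_mul_add (f := Noise.laplace.density) (c := 0) hr
      (Real.exp_pos (ε / 2)).le hT hEm ?_
    · rw [← Noise.laplace.law_eq] at key
      change laplaceMeasure T ≤ _ * laplaceMeasure _ + laplaceMeasure _ at key
      rwa [laplaceMeasure_lt_abs hl0.le, hexpl] at key
    · intro w hw
      have hw : |w| ≤ l := not_lt.mp hw
      rw [laplace_density_eq]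
      beta_reduce
      rw [hdens]
      have h1 := abs_le.mp (Real.abs_exp_sub_one_sub_id_le (x := -t)
        (by rw [abs_neg]; exact ht.trans hb1))
      have h2 : 0 ≤ Real.exp (-t) - 1 := by linarith [Real.one_le_exp (x := -t) (by linarith)]
      have h3 : |w| * (Real.exp (-t) - 1) ≤ l * (Real.exp (-t) - 1) :=
        mul_le_mul_of_nonneg_right hw h2
      have h4 : l * (Real.exp (-t) - 1) ≤ l * (-t + t ^ 2) :=
        mul_le_mul_of_nonneg_left (by nlinarith) hl0.le
      have h5 : l * (-t) ≤ ε / 2 :=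
        (mul_le_mul_of_nonneg_left (by linarith) hl0.le).trans hb2
      -- The quadratic term of `e ^ (-t) - 1 ≤ -t + t ^ 2` is absorbed by the Jacobian factor `e ^
      -- (-t)`.
      have h6 : l * (-t) * (-t) ≤ 1 * (-t) :=
        mul_le_mul_of_nonneg_right (by linarith) (by linarith)
      gcongr
      linarith
  · rcases le_or_gt 1 l with h1 | h1
    · have key := withDensity_le_mul_add (f := Noise.laplace.density) (c := 0) hr
        (Real.exp_pos (ε / 2)).le hT MeasurableSet.empty ?_
      · rw [← Noise.laplace.law_eq, measure_empty, add_zero] at key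
        exact key.trans le_self_add
      · intro w _
        rw [laplace_density_eq]
        beta_reduce
        rw [hdens]
        have h2 : Real.exp (-t) ≤ 1 := Real.exp_le_one_iff.mpr (by linarith)
        have h3 : |w| * Real.exp (-t) ≤ |w| * 1 := mul_le_mul_of_nonneg_left h2 (abs_nonneg w)
        gcongr
        nlinarith
    · have h2 := laplaceMeasure_le_dilation_add h0 (by linarith) hT
      have h3 : Real.exp (-1) ≤ δ := by
        rw [← hexpl]
        exact Real.exp_le_exp.mpr (by linarith)
      have h4 : laplaceMeasure T ≤
          laplaceMeasure {z | 0 + Real.exp t * z ∈ T} + ENNReal.ofReal δ := by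
        rw [← ofReal_measureReal (μ := laplaceMeasure) (s := T),
          ← ofReal_measureReal (μ := laplaceMeasure) (s := {z | 0 + Real.exp t * z ∈ T}),
          ← ENNReal.ofReal_add measureReal_nonneg hδ0.le]
        exact ENNReal.ofReal_le_ofReal (by linarith)
      refine h4.trans (add_le_add ?_ le_rfl)
      refine le_mul_of_one_le_left zero_le ?_
      rw [ENNReal.one_le_ofReal]
      exact Real.one_le_exp (by linarith)

theorem laplace_shift {ε c : ℝ} (hc : |c| ≤ ε / 2) {T : Set ℝ} (hT : MeasurableSet T) :
    laplaceMeasure T ≤ ENNReal.ofReal (Real.exp (ε / 2)) *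
      laplaceMeasure {z | c + 1 * z ∈ T} := by
  have key := withDensity_le_mul_add (f := Noise.laplace.density) (c := c) one_ne_zero
    (Real.exp_pos (ε / 2)).le hT MeasurableSet.empty ?_
  · rwa [← Noise.laplace.law_eq, measure_empty, add_zero] at key
  · intro w _
    rw [laplace_density_eq]
    beta_reduce
    rw [abs_one, inv_one, one_mul, div_one, mul_left_comm, ← Real.exp_add]
    gcongr
    have := abs_sub w c
    linarith

end Laplace

/-! ### Gaussian noise under dilation and shift. -/

section Gaussian

/-- The Chernoff bound with parameter `x`, once for each tail. -/
theorem gaussianReal_lt_abs_le {x : ℝ} (hx : 0 ≤ x) :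
    gaussianReal 0 1 {z | x < |z|} ≤ ENNReal.ofReal (2 * Real.exp (-(x ^ 2 / 2))) := by
  have h1 : (gaussianReal 0 1).real {z | x ≤ z} ≤ Real.exp (-(x ^ 2 / 2)) := by
    have h := measure_ge_le_exp_mul_mgf (μ := gaussianReal 0 1) (X := id) x hx
      (by simpa using integrable_exp_mul_gaussianReal (μ := 0) (v := 1) x)
    rw [mgf_id_gaussianReal] at h
    beta_reduce at h
    rw [← Real.exp_add] at h
    refine h.trans (Real.exp_le_exp.mpr ?_)
    simp only [NNReal.coe_one]
    linarith
  have h2 : gaussianReal 0 1 (Set.Ici x) ≤ ENNReal.ofReal (Real.exp (-(x ^ 2 / 2))) := by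
    change gaussianReal 0 1 {z | x ≤ z} ≤ _
    rw [← ofReal_measureReal]
    exact ENNReal.ofReal_le_ofReal h1
  have h3 := Noise.gaussian.law_neg_preimage (T := Set.Ici x) measurableSet_Ici
  change gaussianReal 0 1 _ = gaussianReal 0 1 _ at h3
  have h4 : {z : ℝ | x < |z|} ⊆ Set.Ici x ∪ {z | -z ∈ Set.Ici x} := by
    intro z hz
    rcases lt_abs.mp (Set.mem_ofPred.mp hz) with h | h
    · exact Or.inl h.le
    · exact Or.inr h.le
  refine (measure_mono h4).trans ((measure_union_le _ _).trans ?_)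
  rw [h3, two_mul, ENNReal.ofReal_add (Real.exp_pos _).le (Real.exp_pos _).le]
  exact add_le_add h2 h2

theorem gaussian_density_eq : Noise.gaussian.density =
    fun x => (Real.sqrt (2 * Real.pi))⁻¹ * Real.exp (-(x ^ 2 / 2)) := rfl

theorem exp_neg_log_two_div {δ : ℝ} (hδ0 : 0 < δ) : Real.exp (-Real.log (2 / δ)) = δ / 2 := by
  rw [← Real.log_inv, inv_div, Real.exp_log (by positivity)]

theorem gaussian_dilation {ε δ b t : ℝ} (hε0 : 0 < ε) (hε1 : ε ≤ 1) (hδ0 : 0 < δ) (hδ1 : δ < 1)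
    (hb : b ≤ ε / (4 * (1 + Real.log (2 / δ)))) (ht : |t| ≤ b) {T : Set ℝ}
    (hT : MeasurableSet T) :
    gaussianReal 0 1 T ≤ ENNReal.ofReal (Real.exp (ε / 2)) *
      gaussianReal 0 1 {z | 0 + Real.exp t * z ∈ T} + ENNReal.ofReal (δ * Real.exp (-1)) := by
  set l := Real.log (2 / δ) with hl
  have hl0 : 0 < l := Real.log_pos (by rw [lt_div_iff₀ hδ0]; linarith)
  have hb2 : (1 + l) * b ≤ ε / 4 := by
    rw [le_div_iff₀ (by positivity)] at hb
    linarith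
  have htb := abs_le.mp ht
  have hb0 : 0 ≤ b := (abs_nonneg t).trans ht
  have hb3 : b ≤ ε / 4 := by nlinarith
  have hr : Real.exp t ≠ 0 := (Real.exp_pos t).ne'
  -- The `+ 2` brings the tail mass from `δ` down to `δ / e`, leaving room for the loss from the
  -- shift.
  have hEm : MeasurableSet {x : ℝ | Real.sqrt (2 * l + 2) < |x|} :=
    measurableSet_lt measurable_const measurable_abs
  have key := withDensity_le_mul_add (f := Noise.gaussian.density) (c := 0) hr
    (Real.exp_pos (ε / 2)).le hT hEm ?_
  · rw [← Noise.gaussian.law_eq] at key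
    refine key.trans (add_le_add le_rfl ((gaussianReal_lt_abs_le (Real.sqrt_nonneg _)).trans
      (ENNReal.ofReal_le_ofReal ?_)))
    have h : -(Real.sqrt (2 * l + 2) ^ 2 / 2) = -l + -1 := by
      rw [Real.sq_sqrt (by positivity)]
      ring
    rw [h, Real.exp_add, hl, exp_neg_log_two_div hδ0]
    linarith
  · intro w hw
    have hw : w ^ 2 ≤ 2 * l + 2 := by
      have h : |w| ≤ Real.sqrt (2 * l + 2) := not_lt.mp hw
      rw [← sq_abs, ← Real.sq_sqrt (show 0 ≤ 2 * l + 2 by positivity)]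
      exact pow_le_pow_left₀ (abs_nonneg w) h 2
    rw [gaussian_density_eq]
    beta_reduce
    have hdens : Real.exp (ε / 2) * (|Real.exp t|⁻¹ *
        ((Real.sqrt (2 * Real.pi))⁻¹ * Real.exp (-(((w - 0) / Real.exp t) ^ 2 / 2)))) =
        (Real.sqrt (2 * Real.pi))⁻¹ *
          Real.exp (ε / 2 - t - w ^ 2 * Real.exp (-(2 * t)) / 2) := by
      have h1 : Real.exp (-(2 * t)) = Real.exp (-t) ^ 2 := by
        rw [← Real.exp_nat_mul]
        push_cast
        ring_nf
      rw [abs_of_pos (Real.exp_pos t), sub_zero, div_eq_mul_inv w, ← Real.exp_neg, mul_pow, ← h1,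
        sub_eq_add_neg (ε / 2 - t), sub_eq_add_neg (ε / 2), Real.exp_add, Real.exp_add]
      ring
    rw [hdens]
    gcongr
    rcases le_or_gt 0 t with h0 | h0
    · have h2 : Real.exp (-(2 * t)) ≤ 1 := Real.exp_le_one_iff.mpr (by linarith)
      have h3 : w ^ 2 * Real.exp (-(2 * t)) ≤ w ^ 2 * 1 :=
        mul_le_mul_of_nonneg_left h2 (sq_nonneg w)
      linarith
    · have h1 := abs_le.mp (Real.abs_exp_sub_one_sub_id_le (x := -(2 * t))
        (by rw [abs_le]; constructor <;> linarith))
      have h2 : 0 ≤ Real.exp (-(2 * t)) - 1 := by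
        linarith [Real.one_le_exp (x := -(2 * t)) (by linarith)]
      have h3 : w ^ 2 * (Real.exp (-(2 * t)) - 1) ≤ (2 * l + 2) * (Real.exp (-(2 * t)) - 1) :=
        mul_le_mul_of_nonneg_right hw h2
      have h4 : (2 * l + 2) * (Real.exp (-(2 * t)) - 1) ≤ (2 * l + 2) * (-(2 * t) + 4 * t ^ 2) :=
        mul_le_mul_of_nonneg_left (by nlinarith) (by positivity)
      have h5 : (1 + l) * (-t) ≤ ε / 4 :=
        (mul_le_mul_of_nonneg_left (by linarith) (by positivity)).trans hb2
      -- As for Laplace noise, the Jacobian pays for the quadratic term.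
      have h6 : (1 + l) * (-t) * (-t) ≤ 1 / 4 * (-t) :=
        mul_le_mul_of_nonneg_right (by linarith) (by linarith)
      linarith

theorem gaussian_shift {ε δ c : ℝ} (hε0 : 0 < ε) (hε1 : ε ≤ 1) (hδ0 : 0 < δ) (hδ1 : δ < 1)
    (hc : |c| ≤ ε / (5 * Real.sqrt (2 * Real.log (2 / δ)))) {T : Set ℝ} (hT : MeasurableSet T) :
    gaussianReal 0 1 T ≤ ENNReal.ofReal (Real.exp (ε / 2)) *
      gaussianReal 0 1 {z | c + 1 * z ∈ T} + ENNReal.ofReal (δ / 8) := by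
  set l := Real.log (2 / δ) with hl
  -- Only `2 * l ≥ 1` matters: it turns `c ^ 2 * (2 * l) ≤ ε ^ 2 / 25` into `c ^ 2 ≤ ε / 25`.
  have hl0 : 0.69 < l := by
    have h : Real.log 2 ≤ l := Real.log_le_log (by norm_num) (by rw [le_div_iff₀ hδ0]; linarith)
    linarith [Real.log_two_gt_d9]
  set u := Real.sqrt (2 * l) with hu
  have hu0 : 0 < u := Real.sqrt_pos.mpr (by linarith)
  have hu2 : u ^ 2 = 2 * l := Real.sq_sqrt (by linarith)
  have hcu : |c| * u ≤ ε / 5 := by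
    rw [le_div_iff₀ (by positivity)] at hc
    linarith
  -- The cut at `2 * u` has tail mass at most `2 (δ / 2) ^ 4 ≤ δ / 8`. Below it the exponents differ
  -- by at most `2 |c| u + c ^ 2 / 2 ≤ 2 ε / 5 + ε / 50`.
  have hEm : MeasurableSet {x : ℝ | 2 * u < |x|} := measurableSet_lt measurable_const measurable_abs
  have key := withDensity_le_mul_add (f := Noise.gaussian.density) (c := c) one_ne_zero
    (Real.exp_pos (ε / 2)).le hT hEm ?_
  · rw [← Noise.gaussian.law_eq] at key
    refine key.trans (add_le_add le_rfl ((gaussianReal_lt_abs_le (by positivity)).trans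
      (ENNReal.ofReal_le_ofReal ?_)))
    have h : -((2 * u) ^ 2 / 2) = (4 : ℕ) * -l := by
      rw [mul_pow, hu2]
      push_cast
      ring
    rw [h, Real.exp_nat_mul, hl, exp_neg_log_two_div hδ0]
    have h3 : δ ^ 3 ≤ 1 := pow_le_one₀ hδ0.le hδ1.le
    have h4 : 2 * (δ / 2) ^ 4 = δ * δ ^ 3 / 8 := by ring
    rw [h4]
    nlinarith
  · intro w hw
    have hw : |w| ≤ 2 * u := not_lt.mp hw
    rw [gaussian_density_eq]
    beta_reduce
    rw [abs_one, inv_one, one_mul, div_one, mul_left_comm, ← Real.exp_add]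
    gcongr
    have h1 : -(w * c) ≤ |c| * (2 * u) := by
      calc -(w * c) ≤ |w * c| := neg_le_abs _
        _ = |c| * |w| := by rw [abs_mul, mul_comm]
        _ ≤ _ := mul_le_mul_of_nonneg_left hw (abs_nonneg c)
    have h2 : c ^ 2 ≤ ε / 25 := by
      have h3 : (|c| * u) ^ 2 ≤ (ε / 5) ^ 2 :=
        pow_le_pow_left₀ (mul_nonneg (abs_nonneg c) hu0.le) hcu 2
      rw [mul_pow, sq_abs, hu2] at h3
      nlinarith [sq_nonneg c]
    nlinarith

end Gaussian

/-! ### From calibrated noise to differential privacy. -/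

theorem Noise.Calibrated.pos {noise : Noise} {ε δ a b : ℝ} (h : noise.Calibrated ε δ a b) :
    0 < a ∧ 0 < b := by
  cases noise
  · exact ⟨h.1, h.2.2.1⟩
  · exact ⟨h.1, h.2.2.1⟩

/-- Calibrated noise tolerates dilations by at most `e ^ b` and shifts by at most `a`. -/
theorem Noise.Calibrated.admissible {noise : Noise} {ε δ a b : ℝ}
    (h : noise.Calibrated ε δ a b) (hε0 : 0 < ε) (hε1 : ε ≤ 1) (hδ0 : 0 < δ) (hδ1 : δ < 1) :
    -- The shift is applied inside the dilation bound, so its loss `δ₂` is multiplied by `e ^ (ε /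
    -- 2)`.
    ∃ δ₁ δ₂ : ℝ, 0 ≤ δ₁ ∧ 0 ≤ δ₂ ∧ Real.exp (ε / 2) * δ₂ + δ₁ ≤ δ ∧
      (∀ t : ℝ, |t| ≤ b → ∀ T : Set ℝ, MeasurableSet T →
        noise.law T ≤ ENNReal.ofReal (Real.exp (ε / 2)) *
          noise.law {z | 0 + Real.exp t * z ∈ T} + ENNReal.ofReal δ₁) ∧
      (∀ c : ℝ, |c| ≤ a → ∀ T : Set ℝ, MeasurableSet T →
        noise.law T ≤ ENNReal.ofReal (Real.exp (ε / 2)) *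
          noise.law {z | c + 1 * z ∈ T} + ENNReal.ofReal δ₂) := by
  cases noise with
  | laplace =>
    obtain ⟨-, ha, -, hb⟩ := h
    refine ⟨δ, 0, hδ0.le, le_rfl, by simp, fun t ht T hT => ?_, fun c hc T hT => ?_⟩
    · exact laplace_dilation hε0 hε1 hδ0 hδ1 hb ht hT
    · exact (laplace_shift (hc.trans ha) hT).trans le_self_add
  | gaussian =>
    obtain ⟨-, ha, -, hb⟩ := h
    refine ⟨δ * Real.exp (-1), δ / 8, by positivity, by positivity, ?_, fun t ht T hT => ?_,
      fun c hc T hT => ?_⟩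
    · have h1 : Real.exp (-1) ≤ 1 / 2 := by linarith [Real.exp_neg_one_lt_d9]
      have h2 : Real.exp (ε / 2) ≤ 3 :=
        (Real.exp_le_exp.mpr (by linarith : ε / 2 ≤ 1)).trans (by linarith [Real.exp_one_lt_d9])
      nlinarith
    · exact gaussian_dilation hε0 hε1 hδ0 hδ1 hb ht hT
    · exact gaussian_shift hε0 hε1 hδ0 hδ1 (hc.trans ha) hT

/-- The intermediate law is that of `A + s' Z`: first the scale changes, by the dilation `s' / s`,
then the centre, by `(A' - A) / s'` in units of the new scale. -/
theorem Noise.Calibrated.law_affine_le {noise : Noise} {ε δ a b : ℝ}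
    (h : noise.Calibrated ε δ a b) (hε0 : 0 < ε) (hε1 : ε ≤ 1) (hδ0 : 0 < δ) (hδ1 : δ < 1)
    {A A' s s' : ℝ} (hs : 0 < s) (hs' : 0 < s') (h1 : s ≤ Real.exp b * s')
    (h2 : s' ≤ Real.exp b * s) (hA : |A - A'| ≤ a * s') {S : Set ℝ} (hS : MeasurableSet S) :
    noise.law {z | A + s * z ∈ S} ≤
      ENNReal.ofReal (Real.exp ε) * noise.law {z | A' + s' * z ∈ S} + ENNReal.ofReal δ := by
  obtain ⟨δ₁, δ₂, hδ₁, hδ₂, hδ, hdil, hshift⟩ := h.admissible hε0 hε1 hδ0 hδ1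
  have hm : ∀ A s : ℝ, MeasurableSet {z | A + s * z ∈ S} := by
    intro A s
    have : Measurable fun z : ℝ => A + s * z := by fun_prop
    exact this hS
  have ht : |Real.log (s' / s)| ≤ b := by
    rw [abs_le]
    constructor
    · rw [Real.le_log_iff_exp_le (div_pos hs' hs), le_div_iff₀ hs, Real.exp_neg,
        inv_mul_le_iff₀ (Real.exp_pos b)]
      exact h1
    · rw [Real.log_le_iff_le_exp (div_pos hs' hs), div_le_iff₀ hs]
      exact h2
  have hc : |(A' - A) / s'| ≤ a := by
    rw [abs_div, abs_of_pos hs', div_le_iff₀ hs', abs_sub_comm]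
    exact hA
  have k1 := hdil _ ht _ (hm A s)
  have k2 := hshift _ hc _ (hm A s')
  have e1 : {z : ℝ | 0 + Real.exp (Real.log (s' / s)) * z ∈ {z | A + s * z ∈ S}} =
      {z | A + s' * z ∈ S} := by
    ext z
    simp only [Set.mem_ofPred_eq]
    rw [Real.exp_log (div_pos hs' hs), zero_add, ← mul_assoc, mul_div_cancel₀ _ hs.ne']
  have e2 : {z : ℝ | (A' - A) / s' + 1 * z ∈ {z | A + s' * z ∈ S}} = {z | A' + s' * z ∈ S} := by
    ext z
    simp only [Set.mem_ofPred_eq]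
    have : A + s' * ((A' - A) / s' + 1 * z) = A' + s' * z := by
      field_simp
      ring
    rw [this]
  rw [e1] at k1
  rw [e2] at k2
  refine k1.trans ((add_le_add (mul_le_mul_right k2 _) le_rfl).trans ?_)
  rw [mul_add, ← mul_assoc, ← ENNReal.ofReal_mul (Real.exp_pos _).le, ← Real.exp_add, add_halves,
    add_assoc, ← ENNReal.ofReal_mul (Real.exp_pos _).le,
    ← ENNReal.ofReal_add (mul_nonneg (Real.exp_pos _).le hδ₂) hδ₁]
  exact add_le_add le_rfl (ENNReal.ofReal_le_ofReal hδ)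

/-- Calibrated noise, scaled by a smooth upper bound `N` on the local sensitivity of `A`, makes the
release of `A` differentially private. -/
theorem Noise.Calibrated.isDP {B : ℝ} {n : ℕ} {noise : Noise} {ε δ a b : ℝ}
    (h : noise.Calibrated ε δ a b) (hε0 : 0 < ε) (hε1 : ε ≤ 1) (hδ0 : 0 < δ) (hδ1 : δ < 1)
    {A N : Stream B n → ℝ} (hN0 : ∀ σ, 0 ≤ N σ)
    (hN : ∀ σ σ', Adjacent σ σ' → N σ ≤ Real.exp b * N σ')
    (hA : ∀ σ σ', Adjacent σ σ' → |A σ - A σ'| ≤ N σ) :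
    IsDP ε δ (fun σ => noise.law.map fun z => A σ + N σ / a * z) := by
  intro σ σ' hadj S hS
  have ha := h.pos.1
  have hm : ∀ σ, Measurable fun z : ℝ => A σ + N σ / a * z := fun σ => by fun_prop
  rw [Measure.map_apply (hm σ) hS, Measure.map_apply (hm σ') hS]
  have h1 := hN σ σ' hadj
  have h2 := hN σ' σ hadj.symm
  have h3 := hA σ' σ hadj.symm
  -- If the scale vanishes at `σ`, it vanishes at `σ'` too and the centres agree, so both outputs
  -- are the same constant.
  rcases (hN0 σ).eq_or_lt with h0 | h0
  · have hz' : N σ' = 0 := le_antisymm (by simpa [← h0] using h2) (hN0 σ')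
    have hAA : A σ = A σ' := by
      rw [hz'] at h3
      linarith [abs_nonpos_iff.mp h3]
    rw [← h0, hz', hAA]
    refine le_trans (le_mul_of_one_le_left zero_le ?_) le_self_add
    rw [ENNReal.one_le_ofReal]
    exact Real.one_le_exp hε0.le
  · have h0' : 0 < N σ' := by
      by_contra! hneg
      nlinarith [Real.exp_pos b]
    refine h.law_affine_le hε0 hε1 hδ0 hδ1 (div_pos h0 ha) (div_pos h0' ha) ?_ ?_ ?_ hS
    · rw [← mul_div_assoc]
      exact div_le_div_of_nonneg_right h1 ha.le
    · rw [← mul_div_assoc]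
      exact div_le_div_of_nonneg_right h2 ha.le
    · rw [mul_div_cancel₀ _ ha.ne', abs_sub_comm]
      exact h3

end ThresholdRelease

/-! ### Privacy and tail bounds of the two thresholds. -/

open ThresholdRelease

theorem mainTheorem1
    (B : ℝ) (hB : 0 < B) (n m : ℕ) (hmn : m ≤ n)
    (p lam : ℝ) (hp0 : 0 < p) (hp1 : p < 1) (hlam0 : 1 < lam * p * (m : ℝ)) (hlam1 : lam < 1)
    (F : MeasureTheory.Measure ℝ) [MeasureTheory.IsProbabilityMeasure F]
    (hF : F (Set.Icc 0 B) = 1)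
    (ε δ : ℝ) (hε0 : 0 < ε) (hε1 : ε ≤ 1) (hδ0 : 0 < δ) (hδ1 : δ < 1)
    (noise : ThresholdRelease.Noise) (a b : ℝ) (hab : noise.Calibrated ε δ a b)
    (βlt βrt : ℝ) (hlt0 : 0 < βlt) (hlt1 : βlt ≤ 1 / 2) (hrt0 : 0 < βrt) (hrt1 : βrt < 1)
    (hκ : 0 < ThresholdRelease.kappa noise.law a b βlt)
    (q : ThresholdRelease.Stream B n → ℝ)
    (hq : q = ThresholdRelease.empiricalQuantile m (lam * p)) :
    -- both forms of the release are differentially private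
    ThresholdRelease.IsDP ε δ
        (fun σ => noise.law.map (ThresholdRelease.tau noise.law a b βlt q σ)) ∧
    ThresholdRelease.IsDP ε δ
        (fun σ => noise.law.map (ThresholdRelease.tauInflated noise.law a b βlt q σ)) ∧
    ∀ σ : ThresholdRelease.Stream B n,
      -- the inflated smooth sensitivity dominates the smooth sensitivity of the shifted quantile
      ThresholdRelease.smoothSensitivity b (ThresholdRelease.tauPrime noise.law a b βlt q) σ ≤
          ThresholdRelease.kappa noise.law a b βlt * ThresholdRelease.smoothSensitivity b q σ ∧
      (∀ z : ℝ, 0 ≤ z →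
        ThresholdRelease.tau noise.law a b βlt q σ z ≤
          ThresholdRelease.tauInflated noise.law a b βlt q σ z) ∧
      -- lower tail
      (ThresholdRelease.quantile F p ≤ q σ →
        noise.law {z | ThresholdRelease.tau noise.law a b βlt q σ z <
            ThresholdRelease.quantile F p} ≤ ENNReal.ofReal βlt ∧
        noise.law {z | ThresholdRelease.tauInflated noise.law a b βlt q σ z <
            ThresholdRelease.quantile F p} ≤ ENNReal.ofReal βlt) ∧
      -- upper tail
      (βrt ≤ 1 / 2 →
        ENNReal.ofReal (1 - βrt) ≤
          noise.law {z | ThresholdRelease.tau noise.law a b βlt q σ z ≤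
            ThresholdRelease.tauMax noise.law a b βlt βrt q σ}) ∧
      ENNReal.ofReal (1 - βrt) ≤
        noise.law {z | ThresholdRelease.tauInflated noise.law a b βlt q σ z ≤
          ThresholdRelease.tauMax noise.law a b βlt βrt q σ} := by
  obtain ⟨ha, hb⟩ := hab.pos
  set g := offset noise.law βlt with hg
  set κ := kappa noise.law a b βlt with hκdef
  set S := smoothSensitivity b q with hS
  have hg0 : 0 ≤ g := offset_nonneg noise hlt1
  have hC : ∀ σ σ', |q σ - q σ'| ≤ B := by
    intro σ σ'
    obtain ⟨h1, h2⟩ := hq ▸ empiricalQuantile_mem_Icc hB.le m (lam * p) σ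
    obtain ⟨h3, h4⟩ := hq ▸ empiricalQuantile_mem_Icc hB.le m (lam * p) σ'
    rw [abs_le]
    constructor <;> linarith
  have hS0 : ∀ σ, 0 ≤ S σ := smoothSensitivity_nonneg b q
  have hSB : ∀ σ, S σ ≤ B := smoothSensitivity_le_of_bound hb.le hB.le hC
  -- The fixed-point equation for `κ`; `κ > 0` excludes the default value `0⁻¹ = 0`.
  have hκt : 1 + κ * ((Real.exp b - 1) * (g / a)) = κ := by
    have h1 : κ⁻¹ = 1 - (Real.exp b - 1) * g / a := by
      rw [hκdef, kappa, inv_inv]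
    have h2 : κ * κ⁻¹ = 1 := mul_inv_cancel₀ hκ.ne'
    rw [h1] at h2
    rw [← mul_div_assoc]
    linarith
  set τ' := tauPrime noise.law a b βlt q with hτ'
  have hτeq : τ' = fun σ => q σ + κ * S σ * (g / a) := by
    funext σ
    change q σ + κ * S σ / a * g = _
    ring
  have hga : 0 ≤ g / a := div_nonneg hg0 ha.le
  have hdom : ∀ σ, smoothSensitivity b τ' σ ≤ κ * S σ := by
    rw [hτeq]
    exact smoothSensitivity_add_mul_le hb.le hB.le hC hκ.le hga hκt
  have hN0 : ∀ σ, 0 ≤ smoothSensitivity b τ' σ := smoothSensitivity_nonneg b τ'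
  have hC'0 : 0 ≤ B + κ * B * (g / a) := by positivity
  have hC' : ∀ σ σ', |τ' σ - τ' σ'| ≤ B + κ * B * (g / a) := by
    intro σ σ'
    have h1 := abs_le.mp (hC σ σ')
    have h2 : ∀ σ, κ * S σ * (g / a) ≤ κ * B * (g / a) := fun σ =>
      mul_le_mul_of_nonneg_right (mul_le_mul_of_nonneg_left (hSB σ) hκ.le) hga
    have h3 : ∀ σ, 0 ≤ κ * S σ * (g / a) := fun σ =>
      mul_nonneg (mul_nonneg hκ.le (hS0 σ)) hga
    rw [hτeq, abs_le]
    constructor <;> linarith [h2 σ, h2 σ', h3 σ, h3 σ']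
  have hloc : ∀ σ σ', Adjacent σ σ' → |τ' σ - τ' σ'| ≤ smoothSensitivity b τ' σ :=
    fun σ σ' h => (abs_sub_le_localSensitivity hC' h).trans
      (localSensitivity_le_smoothSensitivity hb.le hC'0 hC' σ)
  -- The inflated release is also centred at `τ'`, with scale `κ S / a` in place of the exact one,
  -- so the same privacy lemma covers it.
  have hinfl : ∀ σ z, tauInflated noise.law a b βlt q σ z = τ' σ + κ * S σ / a * z := by
    intro σ z
    change q σ + κ * S σ / a * (z + g) = q σ + κ * S σ / a * g + κ * S σ / a * z
    ring
  have htau : ∀ σ z, tau noise.law a b βlt q σ z =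
      q σ + κ * S σ / a * g + smoothSensitivity b τ' σ / a * z := fun _ _ => rfl
  have hmax : ∀ σ, tauMax noise.law a b βlt βrt q σ =
      q σ + κ * S σ / a * (g + offset noise.law βrt) := fun _ => rfl
  have hscale : ∀ σ, smoothSensitivity b τ' σ / a ≤ κ * S σ / a :=
    fun σ => div_le_div_of_nonneg_right (hdom σ) ha.le
  have hscale0 : ∀ σ, 0 ≤ smoothSensitivity b τ' σ / a := fun σ => div_nonneg (hN0 σ) ha.le
  have hinfl0 : ∀ σ, 0 ≤ κ * S σ / a := fun σ => (hscale0 σ).trans (hscale σ)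
  refine ⟨?_, ?_, fun σ => ⟨hdom σ, fun z hz => ?_, fun hx => ⟨?_, ?_⟩, fun hrt => ?_, ?_⟩⟩
  · exact hab.isDP hε0 hε1 hδ0 hδ1 hN0
      (fun σ σ' h => h.smoothSensitivity_le_exp_mul hb.le hC'0 hC') hloc
  · have h1 : ∀ σ, tauInflated noise.law a b βlt q σ = fun z => τ' σ + κ * S σ / a * z :=
      fun σ => funext (hinfl σ)
    simp only [h1]
    refine hab.isDP (N := fun σ => κ * S σ) hε0 hε1 hδ0 hδ1
      (fun σ => mul_nonneg hκ.le (hS0 σ)) (fun σ σ' h => ?_)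
      (fun σ σ' h => (hloc σ σ' h).trans (hdom σ))
    have h2 := mul_le_mul_of_nonneg_left (h.smoothSensitivity_le_exp_mul hb.le hB.le hC) hκ.le
    linarith
  · rw [htau, hinfl]
    exact add_le_add le_rfl (mul_le_mul_of_nonneg_right (hscale σ) hz)
  · refine (measure_mono fun z hz => ?_).trans (law_Iio_neg_offset_le noise hlt0 (by linarith))
    simp only [Set.mem_ofPred_eq, htau] at hz
    by_contra hzg
    have hzg : -g ≤ z := not_lt.mp hzg
    -- For `z ≥ -g` the noise lowers `τ'` by at most `g` times the scale of `τ`, and hence by at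
    -- most the upward shift `κ S g / a`. So `τ` stays at or above the quantile.
    nlinarith [mul_le_mul_of_nonneg_left hzg (hscale0 σ),
      mul_le_mul_of_nonneg_right (hscale σ) hg0]
  · refine (measure_mono fun z hz => ?_).trans (law_Iio_neg_offset_le noise hlt0 (by linarith))
    have hz : q σ + κ * S σ / a * (z + g) < quantile F p := hz
    by_contra hzg
    have hzg : -g ≤ z := not_lt.mp hzg
    have := mul_nonneg (hinfl0 σ) (by linarith : 0 ≤ z + g)
    linarith
  · refine (ofReal_le_law_Iic_offset noise hrt0 hrt1).trans (measure_mono fun z hz => ?_)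
    have hz : z ≤ offset noise.law βrt := hz
    simp only [Set.mem_ofPred_eq, htau, hmax]
    have h1 := mul_le_mul_of_nonneg_left hz (hscale0 σ)
    -- Enlarging the scale of `τ` to `κ S / a` preserves the bound only for a nonnegative offset,
    -- hence `βrt ≤ 1 / 2`.
    have h2 := mul_le_mul_of_nonneg_right (hscale σ) (offset_nonneg noise hrt)
    linarith
  · refine (ofReal_le_law_Iic_offset noise hrt0 hrt1).trans (measure_mono fun z hz => ?_)
    have hz : z ≤ offset noise.law βrt := hz
    have h1 := mul_le_mul_of_nonneg_left hz (hinfl0 σ)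
    change q σ + κ * S σ / a * (z + g) ≤ q σ + κ * S σ / a * (g + offset noise.law βrt)
    linarith
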